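/- Let $m\ge 3$ and $l\ge 1$. The tadpole graph $\mathrm{Tp}_{m,l}$ is the graph on $m+l$ vertices obtained from the disjoint union of the $m$-vertex cycle $C_m$ and the $l$-vertex path $P_l$ by adding an edge between a vertex of $C_m$ and an end of $P_l$. Let $G$ be the graph with labelled vertices $v_1,\dots,v_{m+l}$ obtained from the disjoint union of the cycle $v_1\dotsm v_m v_1$ and the path $v_{m+1}\dotsm v_{m+l}$ by adding the edges $v_1v_{m+1}$ and $v_mv_{m+1}$. For a graph $H$ on labelled vertices $v_1,\dots,v_d$, let $$Y_H=\sum_{\kappa}x_{\kappa(v_1)}\dotsm x_{\kappa(v_d)}$$ be its chromatic symmetric function in the noncommuting variables $x_1,x_2,\dots$, where $\kappa$ runs over all proper colorings of $H$ by positive integers. For a set partition $\pi$ of $\{1,\dots,d\}$ let $$e_\pi=\sum_{(i_1,\dots,i_d)}x_{i_1}\dotsm x_{i_d},$$ where the sum runs over all sequences of positive integers such that $i_j\ne i_k$ whenever $j\neq k$ lie in the same block of $\pi$. Call two set partitions $\pi,\sigma$ of $\{1,\dots,d\}$ congruent if they have the same multiset of block sizes and the block of $\pi$ containing $d$ has the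 same size as the block of $\sigma$ containing $d$. The graph $H$ is called $(e)$-positive if, in the expansion $Y_H=\sum_{\sigma}c_\sigma e_\sigma$ with rational coefficients over all set partitions $\sigma$ of $\{1,\dots,d\}$, one has $\sum_{\sigma\in C}c_\sigma\ge 0$ for every congruence class $C$. Then $G$ is isomorphic to the line graph $L(\mathrm{Tp}_{m,l})$ of the tadpole, and $G$, with this labelling, is $(e)$-positive. -/

import Mathlib

namespace NCSym

/-- Formal power series with rational coefficients in the noncommuting variables `x_1, x_2, …`
(indexed by the positive integers), given by their coefficients on the words in the variables. -/
abbrev NCSeries : Type := FreeMonoid ℕ+ → ℚ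

/-- The noncommutative monomial (word) `x_{s_1} x_{s_2} ⋯ x_{s_d}`. -/
def word {d : ℕ} (s : Fin d → ℕ+) : FreeMonoid ℕ+ :=
  FreeMonoid.ofList (List.ofFn s)

/-- The formal sum `∑_a x_{(s a)_1} ⋯ x_{(s a)_d}` over a family `s` of sequences: the coefficient
of a word is the number of indices `a` that produce it. Below, `s` is always injective, so every
coefficient is `0` or `1`. -/
noncomputable def monomialSum {ι : Type} {d : ℕ} (s : ι → Fin d → ℕ+) : NCSeries :=
  fun w => (Nat.card {a : ι // word (s a) = w} : ℚ)

/-- The chromatic symmetric function `Y_G` in noncommuting variables of a graph with vertices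
`v_1, …, v_d`, summed over all proper colourings by positive integers. The vertex `v_j` is the
element `j - 1` of `Fin d`. -/
noncomputable def chromaticY {d : ℕ} (G : SimpleGraph (Fin d)) : NCSeries :=
  monomialSum (fun κ : G.Coloring ℕ+ => (κ : Fin d → ℕ+))

/-- Set partitions of `{1, …, d}`, with `j` represented by the element `j - 1` of `Fin d`. -/
abbrev SetPartition (d : ℕ) : Type := Finpartition (Finset.univ : Finset (Fin d))

/-- The elementary symmetric function `e_π` in noncommuting variables: the sum of
`x_{i_1} ⋯ x_{i_d}` over all sequences of positive integers whose entries at distinct positions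
in a common block of `π` are distinct. -/
noncomputable def elementaryE {d : ℕ} (π : SetPartition d) : NCSeries :=
  monomialSum (fun s : {s : Fin d → ℕ+ //
    ∀ B ∈ π.parts, ∀ j ∈ B, ∀ k ∈ B, j ≠ k → s j ≠ s k} => s.1)

/-- The type of a set partition: the multiset of its block sizes. -/
def partitionType {d : ℕ} (π : SetPartition d) : Multiset ℕ :=
  π.parts.val.map Finset.card

/-- Congruence of set partitions modulo `i`: same type, and the blocks containing `i` have the
same size. -/
def CongrMod {d : ℕ} (i : Fin d) (π σ : SetPartition d) : Prop :=
  partitionType π = partitionType σ ∧ (π.part i).card = (σ.part i).card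

instance {d : ℕ} (i : Fin d) (π : SetPartition d) : DecidablePred (CongrMod i π) :=
  fun σ => inferInstanceAs
    (Decidable (partitionType π = partitionType σ ∧ (π.part i).card = (σ.part i).card))

/-- `G` is `(e)`-positive modulo `i`: in the expansion `Y_G = ∑ c_σ e_σ` over set partitions,
the sum of the coefficients over each congruence class modulo `i` is nonnegative. -/
def IsEPositiveMod {d : ℕ} (i : Fin d) (G : SimpleGraph (Fin d)) : Prop :=
  ∃ c : SetPartition d → ℚ,
    chromaticY G = ∑ σ, c σ • elementaryE σ ∧
    ∀ π : SetPartition d, 0 ≤ ∑ σ with CongrMod i π σ, c σ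

/-- `G` is `(e)`-positive: it is so modulo its last label `d`. -/
def IsEPositive {d : ℕ} (G : SimpleGraph (Fin d)) : Prop :=
  ∃ i : Fin d, (i : ℕ) + 1 = d ∧ IsEPositiveMod i G

/-- The disjoint union of the cycle `v_1 ⋯ v_m v_1` and the path `v_{m+1} ⋯ v_{m+l}`. -/
def cycleUnionPath (m l : ℕ) : SimpleGraph (Fin (m + l)) :=
  (SimpleGraph.cycleGraph m).map (Fin.castAddEmb l) ⊔
    (SimpleGraph.pathGraph l).map (Fin.natAddEmb m)

/-- The tadpole graph `Tp_{m,l}` on `m + l` vertices: the cycle `C_m` and the path `P_l`, with a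
vertex of the cycle joined by an edge to an end of the path (here `v_m` and `v_{m+1}`).
Equivalently, a vertex of `C_m` is identified with an end of a path with `l` edges. -/
def tadpole (m l : ℕ) : SimpleGraph (Fin (m + l)) :=
  cycleUnionPath m l ⊔
    SimpleGraph.fromRel (fun u v => (u : ℕ) + 1 = m ∧ (v : ℕ) = m)

/-- The labelled graph obtained from the disjoint union of the cycle `v_1 ⋯ v_m v_1` and the path
`v_{m+1} ⋯ v_{m+l}` by adding the edges `v_1 v_{m+1}` and `v_m v_{m+1}`. -/
def labelledLineTadpole (m l : ℕ) : SimpleGraph (Fin (m + l)) :=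
  cycleUnionPath m l ⊔
    SimpleGraph.fromRel (fun u v => ((u : ℕ) = 0 ∨ (u : ℕ) + 1 = m) ∧ (v : ℕ) = m)

end NCSym

namespace NCSym

open Finset Equiv
open scoped Classical

noncomputable section

/-! Write `Y` and `e_π` as functions on colour sequences, and work modulo differences of functions
in the span of the `e_π` that agree up to a permutation of positions fixing the marked (last) one.
Such a permutation carries `e_π` to a congruent `e_σ`, so these differences have zero sum over every
congruence class; it remains to reach nonnegative coefficients modulo them.

Graphs grow one vertex at a time. A new vertex is either free or a copy of an old vertex, and
deletion–contraction expresses each new chromatic function through these two operations. The free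
vertex adds a singleton block. If the marked block of `π` has size `b`, copying the marked vertex
gives `(1/b)(e_s - e_a)` modulo relabelling, where `s` adds the new element as a singleton and `a`
adds it to the marked block (`blockSize_smul_appendCopy_blockInj`).

A pendant vertex contributes free minus copy, namely `(1 - 1/b) e_s + (1/b) e_a`, hence preserves
positivity. The triangle on the cycle contributes free minus two copies, whose coefficient `1 - 2/b`
is negative only for `b = 1`. The cycle avoids this case: paths and cycles can be expanded together,
with coefficients `q ≥ 0` for the path and `q (b - 1)` for the cycle (`path_cycle_mem`), so
singleton marked blocks drop out. Attaching the triangle and then pendant vertices gives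
`lineTadpoleFn_mem`.

The relabelling argument needs copying to preserve the span of the `e_π`. This is clear for power
sums, which lie in that span (`fixedBy_mem`). -/

/-- Functions on the sequences of `d` positive integers. -/
abbrev SeqFn (d : ℕ) : Type := (Fin d → ℕ+) → ℚ

/-! ### Elementary functions and power sums -/

/-- The indicator function of the sequences that are injective on every class of `r`. -/
def blockInj {d : ℕ} (r : Setoid (Fin d)) : SeqFn d :=
  fun s => if ∀ j k, r j k → j ≠ k → s j ≠ s k then 1 else 0

/-- The indicator function of the sequences that are constant on the cycles of `g`. -/
def fixedBy {d : ℕ} (g : Perm (Fin d)) : SeqFn d :=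
  fun s => if ∀ x, s (g x) = s x then 1 else 0

/-- The span of the elementary functions. -/
def eSpan (d : ℕ) : Submodule ℚ (SeqFn d) := Submodule.span ℚ (Set.range blockInj)

lemma blockInj_mem {d : ℕ} (r : Setoid (Fin d)) : blockInj r ∈ eSpan d :=
  Submodule.subset_span ⟨r, rfl⟩

/-- A product of Leibniz expansions over the blocks. On a sequence injective on blocks only `g = 1`
survives; otherwise, multiplying by the transposition of two equal entries in one block is a
sign-reversing involution without fixed points. -/
lemma blockInj_eq_sum_fixedBy {d : ℕ} (r : Setoid (Fin d)) :
    blockInj r = ∑ g : Perm (Fin d) with ∀ x, r x (g x),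
      ((Perm.sign g : ℤ) : ℚ) • fixedBy g := by
  ext s
  simp only [blockInj, Finset.sum_apply, Pi.smul_apply, fixedBy, smul_eq_mul, mul_ite, mul_one,
    mul_zero]
  rw [← Finset.sum_filter, Finset.filter_filter]
  split_ifs with h
  · have : (univ.filter fun g : Perm (Fin d) => (∀ x, r x (g x)) ∧ ∀ x, s (g x) = s x) = {1} := by
      ext g
      simp only [mem_filter, mem_univ, true_and, mem_singleton]
      constructor
      · rintro ⟨h1, h2⟩
        ext x
        by_contra hx
        exact h x (g x) (h1 x) (fun hh => hx (by simp [← hh])) (h2 x).symm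
      · rintro rfl
        exact ⟨fun x => r.refl x, fun x => rfl⟩
    rw [this]
    simp
  · push Not at h
    obtain ⟨j, k, hr, hjk, hs⟩ := h
    symm
    refine Finset.sum_involution (fun g _ => g * swap j k) ?_ ?_ ?_ ?_
    · intro g _
      simp [Perm.sign_mul, Perm.sign_swap hjk]
    · intro g _ _ h
      have : swap j k = 1 := by simpa using h
      exact hjk (swap_eq_one_iff.1 this)
    · intro g hg
      simp only [mem_filter, mem_univ, true_and, Perm.mul_apply] at hg ⊢
      constructor
      · intro x
        rcases eq_or_ne x j with rfl | hxj
        · rw [swap_apply_left]; exact r.trans hr (hg.1 k)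
        rcases eq_or_ne x k with rfl | hxk
        · rw [swap_apply_right]; exact r.trans (r.symm hr) (hg.1 j)
        rw [swap_apply_of_ne_of_ne hxj hxk]; exact hg.1 x
      · intro x
        rw [hg.2]
        rcases eq_or_ne x j with rfl | hxj
        · rw [swap_apply_left, hs]
        rcases eq_or_ne x k with rfl | hxk
        · rw [swap_apply_right, hs]
        rw [swap_apply_of_ne_of_ne hxj hxk]
    · intro g _
      simp [mul_assoc]

lemma cycleType_eq_image_support {d : ℕ} (g : Perm (Fin d)) :
    g.cycleType = (g.support.image fun x => univ.filter (g.SameCycle x)).val.map Finset.card := by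
  have h1 : g.support.image (fun x => univ.filter (g.SameCycle x)) =
      g.cycleFactorsFinset.image Perm.support := by
    ext B
    simp only [mem_image]
    constructor
    · rintro ⟨x, hx, rfl⟩
      refine ⟨g.cycleOf x, Perm.cycleOf_mem_cycleFactorsFinset_iff.2 hx, ?_⟩
      ext y
      rw [Perm.mem_support_cycleOf_iff, mem_filter_univ]
      exact and_iff_left hx
    · rintro ⟨c, hc, rfl⟩
      obtain ⟨x, hx⟩ := (Perm.mem_cycleFactorsFinset_iff.1 hc).1.nonempty_support
      have hcx := Perm.cycle_is_cycleOf hx hc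
      have hxg := Perm.mem_cycleFactorsFinset_support_le hc hx
      refine ⟨x, hxg, ?_⟩
      subst hcx
      ext y
      rw [Perm.mem_support_cycleOf_iff, mem_filter_univ]
      exact (and_iff_left hxg).symm
  rw [h1, Finset.image_val_of_injOn, Multiset.map_map, Perm.cycleType_def]
  intro c hc c' hc' h
  obtain ⟨x, hx⟩ := (Perm.mem_cycleFactorsFinset_iff.1 hc).1.nonempty_support
  rw [Perm.cycle_is_cycleOf hx hc, Perm.cycle_is_cycleOf (h ▸ hx) hc']

lemma sameCycle_apply_eq_of_forall {d : ℕ} {g h : Perm (Fin d)}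
    (H : ∀ x, g.SameCycle x (h x)) {x y : Fin d} (hxy : h.SameCycle x y) : g.SameCycle x y := by
  obtain ⟨n, hn, rfl⟩ := hxy.exists_pow_eq'
  clear hn hxy
  induction n with
  | zero => exact Perm.SameCycle.refl g x
  | succ n ih =>
    rw [pow_succ', Perm.mul_apply]
    exact ih.trans (H _)

lemma fixedBy_apply {d : ℕ} (g : Perm (Fin d)) (s : Fin d → ℕ+) :
    fixedBy g s = if ∀ x y, g.SameCycle x y → s x = s y then 1 else 0 := by
  unfold fixedBy
  congr 1
  refine propext ⟨fun h x y hxy => ?_, fun h x => (h x (g x) ⟨1, rfl⟩).symm⟩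
  obtain ⟨n, hn, rfl⟩ := hxy.exists_pow_eq'
  clear hn hxy
  induction n with
  | zero => simp
  | succ n ih => rw [pow_succ', Perm.mul_apply, h, ih]

/-- The cycle type, hence the sign, can be read off from the partition into cycles. -/
lemma sign_eq_of_sameCycle_iff {d : ℕ} {g h : Perm (Fin d)}
    (H : ∀ x y, g.SameCycle x y ↔ h.SameCycle x y) : Perm.sign g = Perm.sign h := by
  have hs : g.support = h.support := by
    ext x
    have key : ∀ k : Perm (Fin d), x ∈ k.support ↔ ∃ y, y ≠ x ∧ k.SameCycle x y := by
      intro k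
      rw [Perm.mem_support]
      refine ⟨fun hx => ⟨k x, hx, 1, rfl⟩, ?_⟩
      rintro ⟨y, hy, hxy⟩ hx
      exact hy (hxy.eq_of_left hx).symm
    rw [key, key]
    simp only [H]
  have : g.cycleType = h.cycleType := by
    rw [cycleType_eq_image_support, cycleType_eq_image_support, hs]
    simp only [H]
  rw [Perm.sign_of_cycleType, Perm.sign_of_cycleType, this]

/-- Triangular inversion of the signed expansion for the cycle partition of `g`, by induction on the
number of pairs in a common cycle. Terms with strictly finer cycles are covered by induction; those
with the same cycles all equal `fixedBy g` with the same sign, so their total coefficient is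
nonzero. -/
theorem fixedBy_mem {d : ℕ} (g : Perm (Fin d)) : fixedBy g ∈ eSpan d := by
  induction hN : (univ.filter fun p : Fin d × Fin d => g.SameCycle p.1 p.2).card
    using Nat.strong_induction_on generalizing g with
  | _ N ih =>
    subst hN
    have key := blockInj_eq_sum_fixedBy (Perm.SameCycle.setoid g)
    set S : Finset (Perm (Fin d)) :=
      univ.filter fun h => ∀ x, (Perm.SameCycle.setoid g) x (h x) with hS
    rw [← Finset.sum_filter_add_sum_filter_not S
      (fun h => ∀ x y, g.SameCycle x y → h.SameCycle x y)] at key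
    have h1 : ∑ h ∈ S with ∀ x y, g.SameCycle x y → h.SameCycle x y,
        ((Perm.sign h : ℤ) : ℚ) • fixedBy h =
        ((S.filter fun h => ∀ x y, g.SameCycle x y → h.SameCycle x y).card : ℚ) •
          ((Perm.sign g : ℤ) : ℚ) • fixedBy g := by
      rw [Finset.sum_congr rfl (g := fun _ => ((Perm.sign g : ℤ) : ℚ) • fixedBy g)]
      · simp [Nat.cast_smul_eq_nsmul]
      · intro h hh
        rw [mem_filter, hS, mem_filter] at hh
        have H : ∀ x y, g.SameCycle x y ↔ h.SameCycle x y := fun x y =>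
          ⟨hh.2 x y, fun h' => sameCycle_apply_eq_of_forall hh.1.2 h'⟩
        rw [sign_eq_of_sameCycle_iff H]
        congr 1
        ext s
        rw [fixedBy_apply, fixedBy_apply]
        simp only [H]
    have h2 : ∑ h ∈ S with ¬ ∀ x y, g.SameCycle x y → h.SameCycle x y,
        ((Perm.sign h : ℤ) : ℚ) • fixedBy h ∈ eSpan d := by
      refine Submodule.sum_mem _ fun h hh => Submodule.smul_mem _ _ (ih _ ?_ h rfl)
      rw [mem_filter, hS, mem_filter] at hh
      refine Finset.card_lt_card ⟨?_, ?_⟩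
      · intro p hp
        simp only [mem_filter, mem_univ, true_and] at hp ⊢
        exact sameCycle_apply_eq_of_forall hh.1.2 hp
      · intro hsub
        refine hh.2 fun x y hxy => ?_
        have := @hsub (x, y) (by simpa using hxy)
        simpa using this
    have h3 : ((S.filter fun h => ∀ x y, g.SameCycle x y → h.SameCycle x y).card : ℚ) •
          ((Perm.sign g : ℤ) : ℚ) • fixedBy g ∈ eSpan d := by
      rw [← h1, ← (eq_sub_of_add_eq key.symm).symm]
      exact Submodule.sub_mem _ (blockInj_mem _) h2
    rw [Submodule.smul_mem_iff, Submodule.smul_mem_iff] at h3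
    · exact h3
    · exact_mod_cast (Perm.sign g).ne_zero
    · rw [Nat.cast_ne_zero, Finset.card_ne_zero]
      refine ⟨g, ?_⟩
      rw [mem_filter, hS, mem_filter]
      exact ⟨⟨mem_univ _, fun x => ⟨1, rfl⟩⟩, fun _ _ h => h⟩

/-! ### Relabelling and appending a position -/

/-- Permutation of the positions. -/
def relabel {d : ℕ} (τ : Perm (Fin d)) : SeqFn d →ₗ[ℚ] SeqFn d :=
  LinearMap.funLeft ℚ ℚ fun s => s ∘ τ

/-- The span of the differences of elements of `eSpan d` that agree up to a permutation of the
positions fixing `i`. -/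
def relabelSpan {d : ℕ} (i : Fin d) : Submodule ℚ (SeqFn d) :=
  Submodule.span ℚ {D | ∃ F ∈ eSpan d, ∃ τ : Perm (Fin d), τ i = i ∧ D = relabel τ F - F}

/-- Multiplication by a new last free variable. -/
def appendFree (n : ℕ) : SeqFn n →ₗ[ℚ] SeqFn (n + 1) :=
  LinearMap.funLeft ℚ ℚ fun s => s ∘ Fin.castSucc

/-- Induction: the new last entry is a copy of the `j`-th one. -/
def appendCopy {n : ℕ} (j : Fin n) : SeqFn n →ₗ[ℚ] SeqFn (n + 1) where
  toFun F s := if s (Fin.last n) = s j.castSucc then F (s ∘ Fin.castSucc) else 0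
  map_add' F G := by ext s; simp only [Pi.add_apply]; split_ifs <;> simp
  map_smul' q F := by ext s; simp only [Pi.smul_apply]; split_ifs <;> simp

lemma relabel_apply {d : ℕ} (τ : Perm (Fin d)) (F : SeqFn d) (s : Fin d → ℕ+) :
    relabel τ F s = F (s ∘ τ) := rfl

lemma appendFree_apply {n : ℕ} (F : SeqFn n) (s : Fin (n + 1) → ℕ+) :
    appendFree n F s = F (s ∘ Fin.castSucc) := rfl

lemma appendCopy_apply {n : ℕ} (j : Fin n) (F : SeqFn n) (s : Fin (n + 1) → ℕ+) :
    appendCopy j F s = if s (Fin.last n) = s j.castSucc then F (s ∘ Fin.castSucc) else 0 := rfl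

/-- The permutation of `Fin (n + 1)` that extends `τ` and fixes the last element. -/
def extendLast {n : ℕ} (τ : Perm (Fin n)) : Perm (Fin (n + 1)) :=
  (finSuccEquivLast.trans (optionCongr τ)).trans finSuccEquivLast.symm

@[simp] lemma extendLast_last {n : ℕ} (τ : Perm (Fin n)) :
    extendLast τ (Fin.last n) = Fin.last n := by
  simp [extendLast]

@[simp] lemma extendLast_castSucc {n : ℕ} (τ : Perm (Fin n)) (x : Fin n) :
    extendLast τ x.castSucc = (τ x).castSucc := by
  simp [extendLast]

lemma appendFree_relabel {n : ℕ} (τ : Perm (Fin n)) (F : SeqFn n) :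
    appendFree n (relabel τ F) = relabel (extendLast τ) (appendFree n F) := by
  ext s
  simp only [appendFree_apply, relabel_apply]
  congr 1
  ext x
  simp

lemma appendCopy_relabel {n : ℕ} (τ : Perm (Fin n)) (j : Fin n) (F : SeqFn n) :
    appendCopy (τ j) (relabel τ F) = relabel (extendLast τ) (appendCopy j F) := by
  ext s
  simp only [appendCopy_apply, relabel_apply, Function.comp_apply, extendLast_last,
    extendLast_castSucc]
  have : (s ∘ extendLast τ) ∘ Fin.castSucc = (s ∘ Fin.castSucc) ∘ τ := by
    ext x
    simp
  rw [this]

lemma relabel_blockInj {d : ℕ} (τ : Perm (Fin d)) (r : Setoid (Fin d)) :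
    relabel τ (blockInj r) = blockInj (r.comap τ.symm) := by
  ext s
  simp only [relabel_apply, blockInj, Function.comp_apply, Setoid.comap_rel]
  congr 1
  refine propext ⟨fun h j k hr hjk => ?_, fun h j k hr hjk => ?_⟩
  · simpa using h _ _ hr (by simpa using hjk)
  · exact h (τ j) (τ k) (by simpa using hr) (by simpa using hjk)

lemma relabel_mem {d : ℕ} (τ : Perm (Fin d)) {F : SeqFn d} (hF : F ∈ eSpan d) :
    relabel τ F ∈ eSpan d := by
  have : eSpan d ≤ (eSpan d).comap (relabel τ) := by
    refine Submodule.span_le.2 ?_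
    rintro _ ⟨r, rfl⟩
    rw [SetLike.mem_coe, Submodule.mem_comap, relabel_blockInj]
    exact blockInj_mem _
  exact this hF

/-! ### The effect of appending on elementary functions -/

/-- The set partition with a new block that consists of the new last element. -/
def addSingleton {n : ℕ} (r : Setoid (Fin n)) : Setoid (Fin (n + 1)) where
  r x y := x = y ∨ ∃ a b, x = a.castSucc ∧ y = b.castSucc ∧ r a b
  iseqv := by
    refine ⟨fun x => Or.inl rfl, ?_, ?_⟩
    · rintro x y (rfl | ⟨a, b, rfl, rfl, h⟩)
      · exact Or.inl rfl
      · exact Or.inr ⟨b, a, rfl, rfl, r.symm h⟩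
    · rintro x y z (rfl | ⟨a, b, rfl, rfl, h⟩) (rfl | ⟨c, e, hc, rfl, h'⟩)
      · exact Or.inl rfl
      · exact Or.inr ⟨c, e, hc, rfl, h'⟩
      · exact Or.inr ⟨a, b, rfl, rfl, h⟩
      · obtain rfl := Fin.castSucc_injective _ hc
        exact Or.inr ⟨a, e, rfl, rfl, r.trans h h'⟩

/-- The set partition with the new last element added to the block of `i`. -/
def addToBlock {n : ℕ} (i : Fin n) (r : Setoid (Fin n)) : Setoid (Fin (n + 1)) :=
  r.comap (Fin.lastCases i id)

lemma addToBlock_iff {n : ℕ} (i : Fin n) (r : Setoid (Fin n)) (x y : Fin (n + 1)) :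
    addToBlock i r x y ↔ r (Fin.lastCases (motive := fun _ => Fin n) i id x)
      (Fin.lastCases (motive := fun _ => Fin n) i id y) := Iff.rfl

@[simp] lemma addToBlock_castSucc {n : ℕ} (i : Fin n) (r : Setoid (Fin n)) (a b : Fin n) :
    addToBlock i r a.castSucc b.castSucc ↔ r a b := by
  simp [addToBlock_iff]

@[simp] lemma addToBlock_last_castSucc {n : ℕ} (i : Fin n) (r : Setoid (Fin n)) (b : Fin n) :
    addToBlock i r (Fin.last n) b.castSucc ↔ r i b := by
  simp [addToBlock_iff]

/-- The size of the block of `i`. -/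
def blockSize {d : ℕ} (i : Fin d) (r : Setoid (Fin d)) : ℕ := (univ.filter (r i)).card

lemma blockSize_pos {d : ℕ} (i : Fin d) (r : Setoid (Fin d)) : 0 < blockSize i r :=
  Finset.card_pos.2 ⟨i, by simp⟩

lemma blockSize_addSingleton {n : ℕ} (r : Setoid (Fin n)) :
    blockSize (Fin.last n) (addSingleton r) = 1 := by
  rw [blockSize, Finset.card_eq_one]
  refine ⟨Fin.last n, ?_⟩
  ext y
  rw [mem_filter_univ, mem_singleton]
  constructor
  · rintro (h | ⟨a, b, h, -⟩)
    · exact h.symm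
    · exact absurd h.symm (Fin.castSucc_ne_last a)
  · rintro rfl
    exact Or.inl rfl

lemma blockSize_addToBlock {n : ℕ} (i : Fin n) (r : Setoid (Fin n)) :
    blockSize (Fin.last n) (addToBlock i r) = blockSize i r + 1 := by
  have : univ.filter (addToBlock i r (Fin.last n)) =
      insert (Fin.last n) ((univ.filter (r i)).map Fin.castSuccEmb) := by
    ext y
    cases y using Fin.lastCases with
    | last => simp
    | cast y => simp [Fin.castSucc_ne_last]
  rw [blockSize, this, Finset.card_insert_of_notMem (by simp [Fin.castSucc_ne_last]), card_map]
  rfl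

lemma appendFree_blockInj {n : ℕ} (r : Setoid (Fin n)) :
    appendFree n (blockInj r) = blockInj (addSingleton r) := by
  ext s
  simp only [appendFree_apply, blockInj]
  congr 1
  refine propext ⟨?_, ?_⟩
  · rintro h _ _ (rfl | ⟨a, b, rfl, rfl, hr⟩) hxy
    · exact absurd rfl hxy
    · exact h a b hr (fun h => hxy (h ▸ rfl))
  · intro h a b hr hab
    exact h _ _ (Or.inr ⟨a, b, rfl, rfl, hr⟩) (fun h => hab (Fin.castSucc_injective _ h))

lemma blockInj_addToBlock_apply {n : ℕ} (i : Fin n) (r : Setoid (Fin n)) (s : Fin (n + 1) → ℕ+) :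
    blockInj (addToBlock i r) s =
      if ∀ j, r i j → s (Fin.last n) ≠ s j.castSucc then blockInj r (s ∘ Fin.castSucc) else 0 := by
  simp only [blockInj]
  rw [← ite_and]
  congr 1
  refine propext ⟨fun h => ⟨fun j hj => ?_, fun j k hr hjk => ?_⟩, ?_⟩
  · exact h _ _ (by simpa using hj) (Fin.castSucc_ne_last _).symm
  · exact h _ _ (by simpa using hr)
      (fun h => hjk (Fin.castSucc_injective _ h))
  · rintro ⟨h1, h2⟩ x y hr hxy
    cases x using Fin.lastCases with
    | last =>
      cases y using Fin.lastCases with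
      | last => exact absurd rfl hxy
      | cast y => exact h1 y (by simpa using hr)
    | cast x =>
      cases y using Fin.lastCases with
      | last =>
        exact (h1 x ((addToBlock_last_castSucc i r x).1 ((addToBlock i r).symm hr))).symm
      | cast y =>
        exact h2 x y (by simpa using hr) (fun h => hxy (h ▸ rfl))

/-- Entries within a block are distinct, so the new entry equals at most one of them. The sum is
thus the indicator that the new entry repeats one from the block of `i`, which is the complement of
the condition added by `addToBlock`. -/
lemma sum_appendCopy_blockInj {n : ℕ} (i : Fin n) (r : Setoid (Fin n)) :
    ∑ j with r i j, appendCopy j (blockInj r) =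
      blockInj (addSingleton r) - blockInj (addToBlock i r) := by
  rw [← appendFree_blockInj]
  ext s
  rw [Finset.sum_apply, Pi.sub_apply, appendFree_apply, blockInj_addToBlock_apply]
  simp only [appendCopy_apply]
  split_ifs with h
  · rw [sub_self]
    refine Finset.sum_eq_zero fun j hj => if_neg (h j (by simpa using hj))
  · push Not at h
    obtain ⟨j, hj, hs⟩ := h
    rw [sub_zero, Finset.sum_eq_single j, if_pos hs]
    · intro k hk hkj
      rw [ite_eq_right_iff]
      intro hs'
      refine if_neg fun H => H j k ?_ hkj.symm ?_
      · exact r.trans (r.symm hj) (by simpa using hk)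
      · exact hs.symm.trans hs'
    · intro hj'
      exact absurd (by simpa using hj) hj'

/-- The permutation on the right inserts the new element into the cycle of `j`, directly after `j`.
-/
lemma appendCopy_fixedBy {n : ℕ} (j : Fin n) (g : Perm (Fin n)) :
    appendCopy j (fixedBy g) = fixedBy (extendLast g * swap j.castSucc (Fin.last n)) := by
  ext s
  simp only [appendCopy_apply, fixedBy]
  rw [← ite_and]
  congr 1
  simp only [Perm.mul_apply, Function.comp_apply]
  refine propext ⟨?_, fun h => ?_⟩
  · rintro ⟨h1, h2⟩ x
    cases x using Fin.lastCases with
    | last => rw [swap_apply_right, extendLast_castSucc, h2, h1]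
    | cast x =>
      rcases eq_or_ne x j with rfl | hx
      · rw [swap_apply_left, extendLast_last, h1]
      · rw [swap_apply_of_ne_of_ne (fun h => hx (Fin.castSucc_injective _ h))
          (Fin.castSucc_ne_last _), extendLast_castSucc, h2]
  · have h1 : s (Fin.last n) = s j.castSucc := by simpa using h j.castSucc
    refine ⟨h1, fun x => ?_⟩
    rcases eq_or_ne x j with rfl | hx
    · have := h (Fin.last n)
      rw [swap_apply_right, extendLast_castSucc] at this
      rw [this, h1]
    · have := h x.castSucc
      rwa [swap_apply_of_ne_of_ne (fun h => hx (Fin.castSucc_injective _ h))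
          (Fin.castSucc_ne_last _), extendLast_castSucc] at this

lemma appendFree_mem {n : ℕ} {F : SeqFn n} (hF : F ∈ eSpan n) : appendFree n F ∈ eSpan (n + 1) := by
  have : eSpan n ≤ (eSpan (n + 1)).comap (appendFree n) := by
    refine Submodule.span_le.2 ?_
    rintro _ ⟨r, rfl⟩
    rw [SetLike.mem_coe, Submodule.mem_comap, appendFree_blockInj]
    exact blockInj_mem _
  exact this hF

lemma appendCopy_mem {n : ℕ} (j : Fin n) {F : SeqFn n} (hF : F ∈ eSpan n) :
    appendCopy j F ∈ eSpan (n + 1) := by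
  have : eSpan n ≤ (eSpan (n + 1)).comap (appendCopy j) := by
    refine Submodule.span_le.2 ?_
    rintro _ ⟨r, rfl⟩
    rw [SetLike.mem_coe, Submodule.mem_comap, blockInj_eq_sum_fixedBy, map_sum]
    refine Submodule.sum_mem _ fun g _ => ?_
    rw [map_smul, appendCopy_fixedBy]
    exact Submodule.smul_mem _ _ (fixedBy_mem _)
  exact this hF

lemma relabel_sub_mem {d : ℕ} {i : Fin d} {F : SeqFn d} (hF : F ∈ eSpan d) {τ : Perm (Fin d)}
    (hτ : τ i = i) : relabel τ F - F ∈ relabelSpan i :=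
  Submodule.subset_span ⟨F, hF, τ, hτ, rfl⟩

lemma relabelSpan_le_eSpan {d : ℕ} (i : Fin d) : relabelSpan i ≤ eSpan d := by
  refine Submodule.span_le.2 ?_
  rintro _ ⟨F, hF, τ, -, rfl⟩
  exact Submodule.sub_mem _ (relabel_mem τ hF) hF

lemma appendFree_mem_relabelSpan {n : ℕ} (i : Fin n) {F : SeqFn n} (hF : F ∈ relabelSpan i) :
    appendFree n F ∈ relabelSpan (Fin.last n) := by
  have : relabelSpan i ≤ (relabelSpan (Fin.last n)).comap (appendFree n) := by
    refine Submodule.span_le.2 ?_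
    rintro _ ⟨F, hF, τ, -, rfl⟩
    rw [SetLike.mem_coe, Submodule.mem_comap, map_sub, appendFree_relabel]
    exact relabel_sub_mem (appendFree_mem hF) (extendLast_last τ)
  exact this hF

/-- Since `τ` fixes `i`, the copy of `i` is also the copy of `τ i`, and copying commutes with
relabelling. -/
lemma appendCopy_mem_relabelSpan {n : ℕ} (i : Fin n) {F : SeqFn n} (hF : F ∈ relabelSpan i) :
    appendCopy i F ∈ relabelSpan (Fin.last n) := by
  have : relabelSpan i ≤ (relabelSpan (Fin.last n)).comap (appendCopy i) := by
    refine Submodule.span_le.2 ?_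
    rintro _ ⟨F, hF, τ, hτ, rfl⟩
    rw [SetLike.mem_coe, Submodule.mem_comap, map_sub]
    nth_rw 1 [← hτ]
    rw [appendCopy_relabel]
    exact relabel_sub_mem (appendCopy_mem i hF) (extendLast_last τ)
  exact this hF

/-- A symmetry of `F` makes `i` and `τ i` interchangeable as sources of the copy: its extension
fixes the new marked position. -/
lemma appendCopy_sub_appendCopy_mem {n : ℕ} {F : SeqFn n} (hF : F ∈ eSpan n) {τ : Perm (Fin n)}
    (hτ : relabel τ F = F) (i : Fin n) :
    appendCopy (τ i) F - appendCopy i F ∈ relabelSpan (Fin.last n) := by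
  nth_rw 1 [← hτ]
  rw [appendCopy_relabel]
  exact relabel_sub_mem (appendCopy_mem i hF) (extendLast_last τ)

/-- Transposing `i` with another element of its block leaves `blockInj r` unchanged, so all summands
of `sum_appendCopy_blockInj` agree modulo relabelling. -/
theorem blockSize_smul_appendCopy_blockInj {n : ℕ} (i : Fin n) (r : Setoid (Fin n)) :
    (blockSize i r : ℚ) • appendCopy i (blockInj r) -
      (blockInj (addSingleton r) - blockInj (addToBlock i r)) ∈ relabelSpan (Fin.last n) := by
  rw [← sum_appendCopy_blockInj, ← neg_mem_iff, neg_sub, blockSize, Nat.cast_smul_eq_nsmul,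
    ← Finset.sum_const, ← Finset.sum_sub_distrib]
  refine Submodule.sum_mem _ fun j hj => ?_
  have hij : r i j := by simpa using hj
  have := appendCopy_sub_appendCopy_mem (blockInj_mem r) (τ := swap i j) ?_ i
  · rwa [swap_apply_left] at this
  · rw [relabel_blockInj]
    congr 1
    have key : ∀ x, r ((swap i j).symm x) x := by
      intro x
      rw [symm_swap]
      rcases eq_or_ne x i with rfl | hx
      · rw [swap_apply_left]; exact r.symm hij
      rcases eq_or_ne x j with rfl | hx'
      · rw [swap_apply_right]; exact hij
      rw [swap_apply_of_ne_of_ne hx hx']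
    ext x y
    rw [Setoid.comap_rel]
    exact ⟨fun h => r.trans (r.symm (key x)) (r.trans h (key y)),
      fun h => r.trans (key x) (r.trans h (r.symm (key y)))⟩

/-! ### Positive cones and the recursions that preserve them -/

/-- The cone of nonnegative combinations of elementary functions, up to permutations of the
positions fixing `i`. -/
def posCone {d : ℕ} (i : Fin d) : AddSubmonoid (SeqFn d) :=
  AddSubmonoid.closure
    ({F | ∃ (q : ℚ) (r : Setoid (Fin d)), 0 ≤ q ∧ F = q • blockInj r} ∪ relabelSpan i)

/-- The cone of pairs of nonnegative combinations of elementary functions, up to permutations of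
the positions fixing `i`, in which the coefficients of the second component are those of the first
one, multiplied by the size of the block of `i` minus one. -/
def pairCone {d : ℕ} (i : Fin d) : AddSubmonoid (SeqFn d × SeqFn d) :=
  AddSubmonoid.closure
    ({P | ∃ (q : ℚ) (r : Setoid (Fin d)), 0 ≤ q ∧
        P = (q • blockInj r, (q * ((blockSize i r : ℚ) - 1)) • blockInj r)} ∪
      ((relabelSpan i).prod (relabelSpan i)))

lemma smul_blockInj_mem_posCone {d : ℕ} (i : Fin d) {q : ℚ} (hq : 0 ≤ q) (r : Setoid (Fin d)) :
    q • blockInj r ∈ posCone i :=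
  AddSubmonoid.subset_closure (Or.inl ⟨q, r, hq, rfl⟩)

lemma mem_posCone_of_mem_relabelSpan {d : ℕ} {i : Fin d} {F : SeqFn d} (hF : F ∈ relabelSpan i) :
    F ∈ posCone i :=
  AddSubmonoid.subset_closure (Or.inr hF)

lemma mem_posCone_of_sub_mem {d : ℕ} {i : Fin d} {F G : SeqFn d} (hG : G ∈ posCone i)
    (h : F - G ∈ relabelSpan i) : F ∈ posCone i := by
  rw [← add_sub_cancel G F]
  exact add_mem hG (mem_posCone_of_mem_relabelSpan h)

lemma mem_pairCone_of_sub_mem {d : ℕ} {i : Fin d} {P Q : SeqFn d × SeqFn d} (hQ : Q ∈ pairCone i)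
    (h1 : P.1 - Q.1 ∈ relabelSpan i) (h2 : P.2 - Q.2 ∈ relabelSpan i) : P ∈ pairCone i := by
  rw [← add_sub_cancel Q P]
  exact add_mem hQ (AddSubmonoid.subset_closure (Or.inr ⟨h1, h2⟩))

lemma pairCone_snd_mem_eSpan {d : ℕ} {i : Fin d} {P : SeqFn d × SeqFn d} (hP : P ∈ pairCone i) :
    P.2 ∈ eSpan d := by
  induction hP using AddSubmonoid.closure_induction with
  | mem P h =>
    rcases h with ⟨q, r, -, rfl⟩ | h
    · exact Submodule.smul_mem _ _ (blockInj_mem r)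
    · exact relabelSpan_le_eSpan i h.2
  | zero => exact zero_mem _
  | add P Q _ _ hP hQ => exact add_mem hP hQ

/-- Induction of an elementary function, modulo permutations of the old positions. -/
lemma appendCopy_blockInj_sub_mem {n : ℕ} (i : Fin n) (r : Setoid (Fin n)) :
    appendCopy i (blockInj r) - (blockSize i r : ℚ)⁻¹ •
      (blockInj (addSingleton r) - blockInj (addToBlock i r)) ∈ relabelSpan (Fin.last n) := by
  have hb : (blockSize i r : ℚ) ≠ 0 := by exact_mod_cast (blockSize_pos i r).ne'
  have := Submodule.smul_mem _ (blockSize i r : ℚ)⁻¹ (blockSize_smul_appendCopy_blockInj i r)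
  rwa [smul_sub, inv_smul_smul₀ hb] at this

/-- Adding a pendant vertex at the marked vertex preserves positivity. -/
theorem appendFree_sub_appendCopy_mem {n : ℕ} {i : Fin n} {F : SeqFn n} (hF : F ∈ posCone i) :
    appendFree n F - appendCopy i F ∈ posCone (Fin.last n) := by
  induction hF using AddSubmonoid.closure_induction with
  | mem F h =>
    rcases h with ⟨q, r, hq, rfl⟩ | h
    · set b : ℚ := (blockSize i r : ℚ) with hb
      have hb1 : 1 ≤ b := by rw [hb]; exact_mod_cast blockSize_pos i r
      have hG : (q * (1 - b⁻¹)) • blockInj (addSingleton r) +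
          (q * b⁻¹) • blockInj (addToBlock i r) ∈ posCone (Fin.last n) := by
        refine add_mem (smul_blockInj_mem_posCone _ ?_ _) (smul_blockInj_mem_posCone _ ?_ _)
        · exact mul_nonneg hq (sub_nonneg.2 (inv_le_one_of_one_le₀ hb1))
        · positivity
      refine mem_posCone_of_sub_mem hG ?_
      convert Submodule.smul_mem _ (-q) (appendCopy_blockInj_sub_mem i r) using 1
      rw [map_smul, map_smul, appendFree_blockInj, ← hb]
      module
    · exact mem_posCone_of_mem_relabelSpan
        (sub_mem (appendFree_mem_relabelSpan i h) (appendCopy_mem_relabelSpan i h))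
  | zero => simp
  | add F G _ _ hF hG =>
    rw [map_add, map_add, add_sub_add_comm]
    exact add_mem hF hG

/-- Gluing a triangle along an edge at the marked vertex: the coefficients that vanish on singleton
blocks make up for the negative contribution. -/
theorem appendFree_sub_two_appendCopy_mem {n : ℕ} {i : Fin n} {P : SeqFn n × SeqFn n}
    (hP : P ∈ pairCone i) :
    appendFree n P.2 - (2 : ℚ) • appendCopy i P.2 ∈ posCone (Fin.last n) := by
  induction hP using AddSubmonoid.closure_induction with
  | mem P h =>
    rcases h with ⟨q, r, hq, rfl⟩ | h
    · set b : ℚ := (blockSize i r : ℚ) with hb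
      have hb1 : 1 ≤ b := by rw [hb]; exact_mod_cast blockSize_pos i r
      have hG : (q * ((b - 1) * (1 - 2 * b⁻¹))) • blockInj (addSingleton r) +
          (q * ((b - 1) * (2 * b⁻¹))) • blockInj (addToBlock i r) ∈ posCone (Fin.last n) := by
        refine add_mem (smul_blockInj_mem_posCone _ ?_ _) (smul_blockInj_mem_posCone _ ?_ _)
        · refine mul_nonneg hq ?_
          -- The factor `1 - 2/b` is negative only for `b = 1`, where `b - 1` vanishes.
          rcases Nat.eq_or_lt_of_le (blockSize_pos i r) with h1 | h1
          · have : b = 1 := by rw [hb, ← h1]; simp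
            simp [this]
          · have hb2 : 2 ≤ b := by rw [hb]; exact_mod_cast h1
            refine mul_nonneg (by linarith) (sub_nonneg.2 ?_)
            rw [← div_eq_mul_inv]
            exact div_le_one_of_le₀ hb2 (by linarith)
        · have : 0 ≤ b - 1 := by linarith
          positivity
      refine mem_posCone_of_sub_mem hG ?_
      convert Submodule.smul_mem _ (-(2 * (q * (b - 1)))) (appendCopy_blockInj_sub_mem i r) using 1
      rw [map_smul, map_smul, appendFree_blockInj, ← hb]
      module
    · exact mem_posCone_of_mem_relabelSpan (sub_mem (appendFree_mem_relabelSpan i h.2)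
        (Submodule.smul_mem _ _ (appendCopy_mem_relabelSpan i h.2)))
  | zero => simp
  | add P Q _ _ hP hQ =>
    rw [Prod.snd_add, map_add, map_add, smul_add, add_sub_add_comm]
    exact add_mem hP hQ

/-- The recursion for paths and cycles preserves the cone of pairs. -/
theorem path_cycle_step {n : ℕ} {i : Fin n} {P : SeqFn n × SeqFn n} (hP : P ∈ pairCone i) :
    (appendFree n P.1 - appendCopy i P.1,
      appendFree n P.1 - appendCopy i P.1 - appendCopy i P.2) ∈ pairCone (Fin.last n) := by
  induction hP using AddSubmonoid.closure_induction with
  | mem P h =>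
    rcases h with ⟨q, r, hq, rfl⟩ | h
    · set b : ℚ := (blockSize i r : ℚ) with hb
      have hb1 : 1 ≤ b := by rw [hb]; exact_mod_cast blockSize_pos i r
      have hb0 : b ≠ 0 := by positivity
      have hs : ((blockSize (Fin.last n) (addSingleton r) : ℕ) : ℚ) = 1 := by
        rw [blockSize_addSingleton]; simp
      have ht : ((blockSize (Fin.last n) (addToBlock i r) : ℕ) : ℚ) = b + 1 := by
        rw [blockSize_addToBlock, hb]; push_cast; rfl
      have hG := add_mem
        (AddSubmonoid.subset_closure (Or.inl ⟨q * (1 - b⁻¹), addSingleton r,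
          mul_nonneg hq (sub_nonneg.2 (inv_le_one_of_one_le₀ hb1)), rfl⟩) :
            _ ∈ pairCone (Fin.last n))
        (AddSubmonoid.subset_closure (Or.inl ⟨q * b⁻¹, addToBlock i r, by positivity, rfl⟩) :
            _ ∈ pairCone (Fin.last n))
      have hU := appendCopy_blockInj_sub_mem i r
      rw [← hb] at hU
      refine mem_pairCone_of_sub_mem hG ?_ ?_
      · convert Submodule.smul_mem _ (-q) hU using 1
        rw [map_smul, map_smul, appendFree_blockInj]
        simp only [Prod.fst_add]
        module
      · convert Submodule.smul_mem _ (-(q * b)) hU using 1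
        rw [map_smul, map_smul, map_smul, appendFree_blockInj]
        simp only [Prod.snd_add, hs, ht]
        -- The new marked blocks have sizes `1` and `b + 1`, so the second component must be `q •
        -- blockInj (addToBlock i r)`. The two copies contribute `1/b + (b - 1)/b = 1` times `e_s -
        -- e_a`, which cancels `e_s` exactly.
        have hbb : q * b⁻¹ * (b + 1 - 1) = q := by field_simp; ring
        have hbb' : -(q * b) * b⁻¹ = -q := by field_simp
        rw [hbb, smul_sub, smul_smul (-(q * b)) b⁻¹, hbb']
        module
    · have h1 := sub_mem (appendFree_mem_relabelSpan i h.1) (appendCopy_mem_relabelSpan i h.1)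
      exact AddSubmonoid.subset_closure
        (Or.inr ⟨h1, sub_mem h1 (appendCopy_mem_relabelSpan i h.2)⟩)
  | zero =>
    simp only [Prod.fst_zero, Prod.snd_zero, map_zero, sub_zero]
    exact zero_mem (pairCone (Fin.last n))
  | add P Q _ _ hP hQ =>
    convert add_mem hP hQ using 1
    simp only [Prod.fst_add, Prod.snd_add, map_add, Prod.mk_add_mk]
    congr 1 <;> abel

/-! ### From the cone to sums of coefficients over congruence classes -/

/-- The function underlying `elementaryE`. -/
def elementaryFn {d : ℕ} (π : SetPartition d) : SeqFn d :=
  fun s => if ∀ B ∈ π.parts, ∀ j ∈ B, ∀ k ∈ B, j ≠ k → s j ≠ s k then 1 else 0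

lemma elementaryFn_ofSetoid {d : ℕ} (r : Setoid (Fin d)) :
    elementaryFn (Finpartition.ofSetoid r) = blockInj r := by
  ext s
  simp only [elementaryFn, blockInj]
  congr 1
  refine propext ⟨fun h j k hr hjk => ?_, fun h B hB j hj k hk hjk => ?_⟩
  · exact h _ ((Finpartition.ofSetoid r).part_mem.2 (mem_univ j)) j
      (Finpartition.mem_part_ofSetoid_iff_rel.2 (r.refl j)) k
      (Finpartition.mem_part_ofSetoid_iff_rel.2 hr) hjk
  · refine h j k ?_ hjk
    rw [← Finpartition.mem_part_ofSetoid_iff_rel, (Finpartition.ofSetoid r).part_eq_of_mem hB hj]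
    exact hk

lemma part_ofSetoid {d : ℕ} (r : Setoid (Fin d)) (i : Fin d) :
    (Finpartition.ofSetoid r).part i = univ.filter (r i) := by
  ext x
  rw [Finpartition.mem_part_ofSetoid_iff_rel, mem_filter_univ]

lemma parts_ofSetoid {d : ℕ} (r : Setoid (Fin d)) :
    (Finpartition.ofSetoid r).parts = univ.image fun i => univ.filter (r i) := by
  ext B
  rw [mem_image]
  constructor
  · intro hB
    obtain ⟨i, hi⟩ := (Finpartition.ofSetoid r).nonempty_of_mem_parts hB
    exact ⟨i, mem_univ i, by rw [← part_ofSetoid, (Finpartition.ofSetoid r).part_eq_of_mem hB hi]⟩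
  · rintro ⟨i, -, rfl⟩
    rw [← part_ofSetoid]
    exact (Finpartition.ofSetoid r).part_mem.2 (mem_univ i)

lemma filter_comap {d : ℕ} (τ : Perm (Fin d)) (r : Setoid (Fin d)) (i : Fin d) :
    univ.filter (r.comap τ.symm i) = (univ.filter (r (τ.symm i))).map τ.toEmbedding := by
  ext x
  simp [Setoid.comap_rel]

lemma congrMod_comap {d : ℕ} {i : Fin d} {τ : Perm (Fin d)} (hτ : τ i = i) (r : Setoid (Fin d)) :
    CongrMod i (Finpartition.ofSetoid r) (Finpartition.ofSetoid (r.comap τ.symm)) := by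
  constructor
  · have : (Finpartition.ofSetoid (r.comap τ.symm)).parts =
        (Finpartition.ofSetoid r).parts.map (Finset.mapEmbedding τ.toEmbedding).toEmbedding := by
      rw [parts_ofSetoid, parts_ofSetoid, Finset.map_eq_image, Finset.image_image]
      ext B
      simp only [mem_image, mem_univ, true_and, filter_comap, Function.comp_apply]
      constructor
      · rintro ⟨a, rfl⟩
        exact ⟨τ.symm a, rfl⟩
      · rintro ⟨a, rfl⟩
        exact ⟨τ a, by simp⟩
    rw [partitionType, partitionType, this, Finset.map_val, Multiset.map_map]
    refine Multiset.map_congr rfl fun B _ => ?_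
    simp
  · rw [part_ofSetoid, part_ofSetoid, filter_comap, card_map, τ.symm_apply_eq.2 hτ.symm]

/-- The linear combination of elementary functions with given coefficients. -/
def combination (d : ℕ) : (SetPartition d → ℚ) →ₗ[ℚ] SeqFn d :=
  Fintype.linearCombination ℚ elementaryFn

lemma combination_apply {d : ℕ} (c : SetPartition d → ℚ) :
    combination d c = ∑ σ, c σ • elementaryFn σ := rfl

/-- The sum of the coefficients over a congruence class. -/
def classSum {d : ℕ} (i : Fin d) (π : SetPartition d) : (SetPartition d → ℚ) →ₗ[ℚ] ℚ :=
  ∑ σ with CongrMod i π σ, LinearMap.proj σ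

lemma classSum_apply {d : ℕ} (i : Fin d) (π : SetPartition d) (c : SetPartition d → ℚ) :
    classSum i π c = ∑ σ with CongrMod i π σ, c σ := by
  simp [classSum]

lemma classSum_single {d : ℕ} (i : Fin d) (π σ : SetPartition d) (q : ℚ) :
    classSum i π (Pi.single σ q) = if CongrMod i π σ then q else 0 := by
  rw [classSum_apply]
  simp [Pi.single_apply]

lemma combination_single {d : ℕ} (r : Setoid (Fin d)) (q : ℚ) :
    combination d (Pi.single (Finpartition.ofSetoid r) q) = q • blockInj r := by
  rw [combination, Fintype.linearCombination_apply_single, elementaryFn_ofSetoid]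

/-- A relabelled elementary function belongs to a congruent partition, so the coefficients `1` and
`-1` of a generator fall into the same class. -/
lemma exists_combination_of_mem_relabelSpan {d : ℕ} {i : Fin d} {F : SeqFn d}
    (hF : F ∈ relabelSpan i) : ∃ c, combination d c = F ∧ ∀ π, classSum i π c = 0 := by
  have : relabelSpan i ≤ (⨅ π, LinearMap.ker (classSum i π)).map (combination d) := by
    refine Submodule.span_le.2 ?_
    rintro _ ⟨F, hF, τ, hτ, rfl⟩
    have : eSpan d ≤ ((⨅ π, LinearMap.ker (classSum i π)).map (combination d)).comap
        (relabel τ - LinearMap.id) := by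
      refine Submodule.span_le.2 ?_
      rintro _ ⟨r, rfl⟩
      refine ⟨Pi.single (Finpartition.ofSetoid (r.comap τ.symm)) 1 -
        Pi.single (Finpartition.ofSetoid r) 1, ?_, ?_⟩
      · rw [SetLike.mem_coe, Submodule.mem_iInf]
        intro π
        have h := congrMod_comap hτ r
        have : CongrMod i π (Finpartition.ofSetoid (r.comap τ.symm)) ↔
            CongrMod i π (Finpartition.ofSetoid r) := by
          unfold CongrMod at h ⊢
          rw [h.1, h.2]
        rw [LinearMap.mem_ker, map_sub, classSum_single, classSum_single]
        simp only [this, sub_self]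
      · rw [map_sub, combination_single, combination_single, LinearMap.sub_apply,
          relabel_blockInj, one_smul, one_smul, LinearMap.id_apply]
    exact this hF
  obtain ⟨c, hc, rfl⟩ := this hF
  rw [SetLike.mem_coe, Submodule.mem_iInf] at hc
  exact ⟨c, rfl, hc⟩

theorem exists_combination_of_mem_posCone {d : ℕ} {i : Fin d} {F : SeqFn d}
    (hF : F ∈ posCone i) : ∃ c, combination d c = F ∧ ∀ π, 0 ≤ classSum i π c := by
  induction hF using AddSubmonoid.closure_induction with
  | mem F h =>
    rcases h with ⟨q, r, hq, rfl⟩ | h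
    · refine ⟨_, combination_single r q, fun π => ?_⟩
      rw [classSum_single]
      split_ifs <;> simp [hq]
    · obtain ⟨c, hc, h0⟩ := exists_combination_of_mem_relabelSpan h
      exact ⟨c, hc, fun π => (h0 π).ge⟩
  | zero => exact ⟨0, map_zero _, fun π => by rw [map_zero]⟩
  | add F G _ _ hF hG =>
    obtain ⟨c, hc, h0⟩ := hF
    obtain ⟨c', hc', h0'⟩ := hG
    refine ⟨c + c', by rw [map_add, hc, hc'], fun π => ?_⟩
    rw [map_add]
    exact add_nonneg (h0 π) (h0' π)

/-! ### From functions on sequences to noncommutative series -/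

lemma word_injective {d : ℕ} : Function.Injective (word (d := d)) := fun _ _ h =>
  List.ofFn_injective (FreeMonoid.ofList.injective h)

lemma monomialSum_word {ι : Type} {d : ℕ} {f : ι → Fin d → ℕ+} (hf : Function.Injective f)
    (s : Fin d → ℕ+) : monomialSum f (word s) = if ∃ a, f a = s then 1 else 0 := by
  unfold monomialSum
  split_ifs with h
  · obtain ⟨a, rfl⟩ := h
    rw [Nat.cast_eq_one, Nat.card_eq_one_iff_exists]
    exact ⟨⟨a, rfl⟩, fun b => Subtype.ext (hf (word_injective b.2))⟩
  · rw [Nat.cast_eq_zero, Nat.card_eq_zero]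
    exact Or.inl ⟨fun b => h ⟨b.1, word_injective b.2⟩⟩

lemma monomialSum_of_not_word {ι : Type} {d : ℕ} (f : ι → Fin d → ℕ+) {w : FreeMonoid ℕ+}
    (hw : ∀ s : Fin d → ℕ+, word s ≠ w) : monomialSum f w = 0 := by
  unfold monomialSum
  rw [Nat.cast_eq_zero, Nat.card_eq_zero]
  exact Or.inl ⟨fun b => hw _ b.2⟩

/-- The indicator function of the proper colourings. -/
def chromaticFn {d : ℕ} (G : SimpleGraph (Fin d)) : SeqFn d :=
  fun s => if ∀ j k, G.Adj j k → s j ≠ s k then 1 else 0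

lemma chromaticY_word {d : ℕ} (G : SimpleGraph (Fin d)) (s : Fin d → ℕ+) :
    chromaticY G (word s) = chromaticFn G s := by
  rw [chromaticY, monomialSum_word DFunLike.coe_injective, chromaticFn]
  congr 1
  refine propext ⟨?_, fun h => ⟨SimpleGraph.Coloring.mk s fun {j k} => h j k, rfl⟩⟩
  rintro ⟨κ, rfl⟩ j k hjk
  exact κ.valid hjk

lemma elementaryE_word {d : ℕ} (π : SetPartition d) (s : Fin d → ℕ+) :
    elementaryE π (word s) = elementaryFn π s := by
  rw [elementaryE, monomialSum_word Subtype.val_injective, elementaryFn]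
  congr 1
  exact propext ⟨fun ⟨t, ht⟩ => ht ▸ t.2, fun h => ⟨⟨s, h⟩, rfl⟩⟩

theorem isEPositiveMod_of_mem_posCone {d : ℕ} {i : Fin d} {G : SimpleGraph (Fin d)}
    (h : chromaticFn G ∈ posCone i) : IsEPositiveMod i G := by
  obtain ⟨c, hc, h0⟩ := exists_combination_of_mem_posCone h
  refine ⟨c, ?_, fun π => ?_⟩
  · ext w
    rw [Finset.sum_apply]
    simp only [Pi.smul_apply]
    by_cases hw : ∃ s : Fin d → ℕ+, word s = w
    · obtain ⟨s, rfl⟩ := hw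
      rw [chromaticY_word, ← hc, combination_apply, Finset.sum_apply]
      simp only [Pi.smul_apply, elementaryE_word]
    · push Not at hw
      rw [chromaticY, monomialSum_of_not_word _ hw]
      simp only [elementaryE, monomialSum_of_not_word _ hw, smul_zero, Finset.sum_const_zero]
  · rw [← classSum_apply]
    exact h0 π

/-! ### Deletion–contraction for paths, cycles and line graphs of tadpoles -/

/-- The indicator function of the proper colourings of the path. -/
def pathFn (n : ℕ) : SeqFn n :=
  fun s => if ∀ j k : Fin n, (j : ℕ) + 1 = k → s j ≠ s k then 1 else 0

/-- The indicator function of the proper colourings of the cycle; it is zero on one vertex, which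
counts as a loop. -/
def cycleFn (n : ℕ) : SeqFn n :=
  fun s => if ∀ j k : Fin n, ((j : ℕ) + 1 = k ∨ ((j : ℕ) = 0 ∧ (k : ℕ) + 1 = n)) → s j ≠ s k
    then 1 else 0

/-- The indicator function of the proper colourings of the line graph of the tadpole whose cycle
has `m` vertices, restricted to the first `n` vertices. -/
def lineTadpoleFn (m n : ℕ) : SeqFn n :=
  fun s => if ∀ j k : Fin n,
      ((j : ℕ) + 1 = k ∨ ((j : ℕ) = 0 ∧ ((k : ℕ) + 1 = m ∨ (k : ℕ) = m))) → s j ≠ s k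
    then 1 else 0

lemma forall_fin_succ_pair {n : ℕ} {R : ℕ → ℕ → Prop} (hR : ∀ j k, R j k → j < k)
    (s : Fin (n + 1) → ℕ+) :
    (∀ j k : Fin (n + 1), R j k → s j ≠ s k) ↔
      (∀ j k : Fin n, R j k → (s ∘ Fin.castSucc) j ≠ (s ∘ Fin.castSucc) k) ∧
        ∀ j : Fin n, R j n → s (Fin.last n) ≠ s j.castSucc := by
  constructor
  · intro h
    exact ⟨fun j k hjk => h _ _ hjk, fun j hj => (h j.castSucc (Fin.last n) (by simpa using hj)).symm⟩
  · rintro ⟨h1, h2⟩ j k hjk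
    have hlt := hR _ _ hjk
    cases j using Fin.lastCases with
    | last => have := k.isLt; simp at hlt; omega
    | cast j =>
      cases k using Fin.lastCases with
      | last => exact (h2 j (by simpa using hjk)).symm
      | cast k => exact h1 j k (by simpa using hjk)

lemma ite_and_ne (A : Prop) (x y : ℕ+) [Decidable A] [Decidable (A ∧ x ≠ y)] :
    (if A ∧ x ≠ y then 1 else 0 : ℚ) =
      (if A then 1 else 0) - if x = y then (if A then 1 else 0) else 0 := by
  by_cases hA : A <;> by_cases h : x = y <;> simp [hA, h]

lemma pathFn_succ (n : ℕ) :
    pathFn (n + 2) =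
      appendFree (n + 1) (pathFn (n + 1)) - appendCopy (Fin.last n) (pathFn (n + 1)) := by
  ext s
  rw [Pi.sub_apply, appendFree_apply, appendCopy_apply]
  simp only [pathFn]
  have h1 := forall_fin_succ_pair (R := fun j k => j + 1 = k) (by omega) s
  have h2 : (∀ j : Fin (n + 1), (j : ℕ) + 1 = n + 1 → s (Fin.last (n + 1)) ≠ s j.castSucc) ↔
      s (Fin.last (n + 1)) ≠ s (Fin.last n).castSucc := by
    refine ⟨fun h => h _ (by simp), fun h j hj => ?_⟩
    obtain rfl : j = Fin.last n := Fin.ext (by simpa using hj)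
    exact h
  rw [h2] at h1
  simp only [h1]
  exact ite_and_ne _ _ _

lemma cycleFn_apply (n : ℕ) (s : Fin (n + 1) → ℕ+) :
    cycleFn (n + 1) s = if s (Fin.last n) ≠ s 0 then pathFn (n + 1) s else 0 := by
  simp only [cycleFn, pathFn]
  rw [← ite_and]
  congr 1
  refine propext ⟨fun h => ⟨(h 0 (Fin.last n) (by simp)).symm, fun j k hjk => h j k (Or.inl hjk)⟩, ?_⟩
  rintro ⟨h1, h2⟩ j k (hjk | ⟨hj, hk⟩)
  · exact h2 j k hjk
  · obtain rfl : j = 0 := Fin.ext hj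
    obtain rfl : k = Fin.last n := Fin.ext (by simpa using hk)
    exact h1.symm

/-- Deletion–contraction at the closing edge: path colourings whose last entry equals the first are
colourings of the shorter cycle with its first entry copied. The loop convention makes this valid
from one vertex on. -/
lemma cycleFn_succ (n : ℕ) :
    cycleFn (n + 2) = pathFn (n + 2) - appendCopy 0 (cycleFn (n + 1)) := by
  ext s
  rw [Pi.sub_apply, cycleFn_apply, pathFn_succ, Pi.sub_apply, appendFree_apply, appendCopy_apply,
    appendCopy_apply, cycleFn_apply]
  simp only [Function.comp_apply, Fin.castSucc_zero]
  rcases eq_or_ne (s (Fin.last (n + 1))) (s 0) with h | h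
  · rcases eq_or_ne (s (Fin.last n).castSucc) (s 0) with h' | h'
    · simp [h, h']
    · simp [h, h', h'.symm]
  · simp [h]

lemma relabel_rev_cycleFn (n : ℕ) : relabel Fin.revPerm (cycleFn n) = cycleFn n := by
  ext s
  simp only [relabel_apply, cycleFn, Function.comp_apply, Fin.revPerm_apply]
  congr 1
  refine propext ⟨fun h j k hjk => ?_, fun h j k hjk => ?_⟩
  · have := h k.rev j.rev (by simp only [Fin.val_rev]; omega)
    simpa using this.symm
  · exact (h k.rev j.rev (by simp only [Fin.val_rev]; omega)).symm

theorem path_cycle_mem (n : ℕ) :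
    (pathFn (n + 1), cycleFn (n + 1)) ∈ pairCone (Fin.last n) := by
  induction n with
  | zero =>
    -- The marked block has size one, so the second component is zero, matching the loop convention
    -- for `cycleFn 1`.
    refine AddSubmonoid.subset_closure (Or.inl ⟨1, ⊥, zero_le_one, ?_⟩)
    have hb : blockSize (Fin.last 0) (⊥ : Setoid (Fin 1)) = 1 :=
      le_antisymm (Finset.card_le_univ _) (blockSize_pos _ _)
    have h1 : pathFn 1 = blockInj ⊥ := by
      ext s
      simp [pathFn, blockInj]
    have h2 : cycleFn 1 = 0 := by
      ext s
      rw [cycleFn_apply, if_neg (by simp), Pi.zero_apply]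
    rw [h1, h2, hb]
    simp
  | succ n ih =>
    refine mem_pairCone_of_sub_mem (path_cycle_step ih) ?_ ?_
    · simp only [pathFn_succ, sub_self]
      exact zero_mem _
    · simp only [cycleFn_succ, pathFn_succ]
      -- The cycle recursion copies the first vertex, while `path_cycle_step` copies the last;
      -- reversal of the cycle exchanges them.
      rw [sub_sub_sub_cancel_left, ← neg_mem_iff, neg_sub]
      have := appendCopy_sub_appendCopy_mem (pairCone_snd_mem_eSpan ih)
        (relabel_rev_cycleFn (n + 1)) (Fin.last n)
      rwa [Fin.revPerm_apply, Fin.rev_last] at this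

/-- Inclusion–exclusion over the two edges at the new vertex. There is no double term, since the two
ends of the cycle word have different colours. -/
lemma lineTadpoleFn_base (n : ℕ) :
    lineTadpoleFn (n + 1) (n + 2) = appendFree (n + 1) (cycleFn (n + 1)) -
      appendCopy 0 (cycleFn (n + 1)) - appendCopy (Fin.last n) (cycleFn (n + 1)) := by
  ext s
  rw [Pi.sub_apply, Pi.sub_apply, appendFree_apply, appendCopy_apply, appendCopy_apply]
  have h1 : lineTadpoleFn (n + 1) (n + 2) s =
      if (s (Fin.last (n + 1)) ≠ s (Fin.castSucc 0) ∧
        s (Fin.last (n + 1)) ≠ s (Fin.last n).castSucc) then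
        cycleFn (n + 1) (s ∘ Fin.castSucc) else 0 := by
    simp only [lineTadpoleFn, cycleFn]
    rw [← ite_and]
    congr 1
    refine propext ⟨fun h => ⟨⟨?_, ?_⟩, fun j k hjk => ?_⟩, ?_⟩
    · exact (h 0 (Fin.last (n + 1)) (by simp)).symm
    · exact (h (Fin.last n).castSucc (Fin.last (n + 1)) (by simp)).symm
    · exact h j.castSucc k.castSucc (by simp only [Fin.val_castSucc]; omega)
    · rintro ⟨⟨h1, h2⟩, h3⟩ j k hjk
      cases j using Fin.lastCases with
      | last => have := k.isLt; simp only [Fin.val_last] at hjk; omega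
      | cast j =>
        cases k using Fin.lastCases with
        | last =>
          simp only [Fin.val_castSucc, Fin.val_last] at hjk
          rcases hjk with hj | ⟨hj, -⟩
          · obtain rfl : j = Fin.last n := Fin.ext (by simpa using hj)
            exact h2.symm
          · obtain rfl : j = 0 := Fin.ext hj
            exact h1.symm
        | cast k =>
          refine h3 j k ?_
          have := k.isLt
          simp only [Fin.val_castSucc] at hjk
          omega
  rw [h1, cycleFn_apply]
  simp only [Function.comp_apply]
  split_ifs <;> simp_all

/-- By `h` the new vertex lies beyond the triangle, so its only earlier neighbour is the previous
vertex. -/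
lemma lineTadpoleFn_succ {m n : ℕ} (h : m < n + 1) :
    lineTadpoleFn m (n + 2) = appendFree (n + 1) (lineTadpoleFn m (n + 1)) -
      appendCopy (Fin.last n) (lineTadpoleFn m (n + 1)) := by
  ext s
  rw [Pi.sub_apply, appendFree_apply, appendCopy_apply]
  simp only [lineTadpoleFn]
  have key : (∀ j k : Fin (n + 2),
      ((j : ℕ) + 1 = k ∨ ((j : ℕ) = 0 ∧ ((k : ℕ) + 1 = m ∨ (k : ℕ) = m))) → s j ≠ s k) ↔
      (∀ j k : Fin (n + 1),
      ((j : ℕ) + 1 = k ∨ ((j : ℕ) = 0 ∧ ((k : ℕ) + 1 = m ∨ (k : ℕ) = m))) →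
        (s ∘ Fin.castSucc) j ≠ (s ∘ Fin.castSucc) k) ∧
      s (Fin.last (n + 1)) ≠ s (Fin.last n).castSucc := by
    refine ⟨fun H => ⟨fun j k hjk => H _ _ hjk, ?_⟩, ?_⟩
    · exact (H (Fin.last n).castSucc (Fin.last (n + 1)) (by simp)).symm
    · rintro ⟨h1, h2⟩ j k hjk
      cases k using Fin.lastCases with
      | last =>
        simp only [Fin.val_last] at hjk
        obtain rfl : j = (Fin.last n).castSucc :=
          Fin.ext (by simp only [Fin.val_castSucc, Fin.val_last]; omega)
        exact h2.symm
      | cast k =>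
        cases j using Fin.lastCases with
        | last =>
          have := k.isLt
          simp only [Fin.val_last, Fin.val_castSucc] at hjk
          omega
        | cast j => exact h1 j k hjk
  simp only [key]
  exact ite_and_ne _ _ _

theorem lineTadpoleFn_mem (m l : ℕ) :
    lineTadpoleFn (m + 1) (m + 1 + l + 1) ∈ posCone (Fin.last (m + 1 + l)) := by
  induction l with
  | zero =>
    have hP := path_cycle_mem m
    refine mem_posCone_of_sub_mem (appendFree_sub_two_appendCopy_mem hP) ?_
    have := appendCopy_sub_appendCopy_mem (pairCone_snd_mem_eSpan hP)
      (relabel_rev_cycleFn (m + 1)) (Fin.last m)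
    rw [Fin.revPerm_apply, Fin.rev_last] at this
    change lineTadpoleFn (m + 1) (m + 2) - (appendFree (m + 1) (cycleFn (m + 1)) -
      (2 : ℚ) • appendCopy (Fin.last m) (cycleFn (m + 1))) ∈ relabelSpan (Fin.last (m + 1))
    convert neg_mem this using 1
    rw [lineTadpoleFn_base]
    module
  | succ l ih =>
    rw [← Nat.add_assoc, lineTadpoleFn_succ (by omega)]
    exact appendFree_sub_appendCopy_mem ih

/-! ### Adjacency in terms of labels -/

lemma cycleGraph_adj_iff {m : ℕ} (hm : 3 ≤ m) (u v : Fin m) :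
    (SimpleGraph.cycleGraph m).Adj u v ↔
      ((u : ℕ) + 1 = v ∨ ((u : ℕ) = 0 ∧ (v : ℕ) + 1 = m)) ∨
        ((v : ℕ) + 1 = u ∨ ((v : ℕ) = 0 ∧ (u : ℕ) + 1 = m)) := by
  rw [SimpleGraph.cycleGraph_adj']
  have key : ∀ a b : Fin m, (a - b).val = 1 ↔
      ((b : ℕ) + 1 = a ∨ ((a : ℕ) = 0 ∧ (b : ℕ) + 1 = m)) := by
    intro a b
    have ha := a.isLt
    have hb := b.isLt
    rw [Fin.val_sub]
    rcases le_or_gt (b : ℕ) (a : ℕ) with h | h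
    · rw [show m - (b : ℕ) + a = (a - b) + m by omega, Nat.add_mod_right,
        Nat.mod_eq_of_lt (by omega)]
      omega
    · rw [Nat.mod_eq_of_lt (by omega)]
      omega
  rw [key, key]
  tauto

lemma cycleUnionPath_adj_iff {m l : ℕ} (hm : 3 ≤ m) (u v : Fin (m + l)) :
    (cycleUnionPath m l).Adj u v ↔
      (((u : ℕ) + 1 = v ∧ (v : ℕ) ≠ m) ∨ ((u : ℕ) = 0 ∧ (v : ℕ) + 1 = m)) ∨
        (((v : ℕ) + 1 = u ∧ (u : ℕ) ≠ m) ∨ ((v : ℕ) = 0 ∧ (u : ℕ) + 1 = m)) := by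
  rw [cycleUnionPath, SimpleGraph.sup_adj]
  cases u using Fin.addCases with
  | left u =>
    cases v using Fin.addCases with
    | left v =>
      have h1 := SimpleGraph.map_adj_apply (G := SimpleGraph.cycleGraph m)
        (f := Fin.castAddEmb l) (a := u) (b := v)
      have h2 : ¬ ((SimpleGraph.pathGraph l).map (Fin.natAddEmb m)).Adj
          (Fin.castAdd l u) (Fin.castAdd l v) := by
        rw [SimpleGraph.map_adj]
        rintro ⟨a, b, -, ha, -⟩
        have := congrArg Fin.val ha
        simp at this
        omega
      simp only [Fin.castAddEmb_apply] at h1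
      rw [h1, cycleGraph_adj_iff hm]
      simp only [h2, or_false, Fin.val_castAdd]
      omega
    | right v =>
      have h1 : ¬ ((SimpleGraph.cycleGraph m).map (Fin.castAddEmb l)).Adj
          (Fin.castAdd l u) (Fin.natAdd m v) := by
        rw [SimpleGraph.map_adj]
        rintro ⟨a, b, -, -, hb⟩
        have := congrArg Fin.val hb
        simp at this
        omega
      have h2 : ¬ ((SimpleGraph.pathGraph l).map (Fin.natAddEmb m)).Adj
          (Fin.castAdd l u) (Fin.natAdd m v) := by
        rw [SimpleGraph.map_adj]
        rintro ⟨a, b, -, ha, -⟩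
        have := congrArg Fin.val ha
        simp at this
        omega
      simp only [h1, h2, or_false, Fin.val_castAdd, Fin.val_natAdd, false_iff]
      omega
  | right u =>
    cases v using Fin.addCases with
    | left v =>
      have h1 : ¬ ((SimpleGraph.cycleGraph m).map (Fin.castAddEmb l)).Adj
          (Fin.natAdd m u) (Fin.castAdd l v) := by
        rw [SimpleGraph.map_adj]
        rintro ⟨a, b, -, ha, -⟩
        have := congrArg Fin.val ha
        simp at this
        omega
      have h2 : ¬ ((SimpleGraph.pathGraph l).map (Fin.natAddEmb m)).Adj
          (Fin.natAdd m u) (Fin.castAdd l v) := by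
        rw [SimpleGraph.map_adj]
        rintro ⟨a, b, -, -, hb⟩
        have := congrArg Fin.val hb
        simp at this
        omega
      simp only [h1, h2, or_false, Fin.val_castAdd, Fin.val_natAdd, false_iff]
      omega
    | right v =>
      have h1 : ¬ ((SimpleGraph.cycleGraph m).map (Fin.castAddEmb l)).Adj
          (Fin.natAdd m u) (Fin.natAdd m v) := by
        rw [SimpleGraph.map_adj]
        rintro ⟨a, b, -, ha, -⟩
        have := congrArg Fin.val ha
        simp at this
        omega
      have h2 := SimpleGraph.map_adj_apply (G := SimpleGraph.pathGraph l)
        (f := Fin.natAddEmb m) (a := u) (b := v)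
      simp only [Fin.natAddEmb_apply] at h2
      rw [h2, SimpleGraph.pathGraph_adj]
      simp only [h1, false_or, Fin.val_natAdd]
      omega

lemma tadpole_adj_iff {m l : ℕ} (hm : 3 ≤ m) (u v : Fin (m + l)) :
    (tadpole m l).Adj u v ↔
      ((u : ℕ) + 1 = v ∨ ((u : ℕ) = 0 ∧ (v : ℕ) + 1 = m)) ∨
        ((v : ℕ) + 1 = u ∨ ((v : ℕ) = 0 ∧ (u : ℕ) + 1 = m)) := by
  rw [tadpole, SimpleGraph.sup_adj, cycleUnionPath_adj_iff hm, SimpleGraph.fromRel_adj]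
  simp only [ne_eq, Fin.ext_iff]
  omega

lemma labelledLineTadpole_adj_iff {m l : ℕ} (hm : 3 ≤ m) (u v : Fin (m + l)) :
    (labelledLineTadpole m l).Adj u v ↔
      ((u : ℕ) + 1 = v ∨ ((u : ℕ) = 0 ∧ ((v : ℕ) + 1 = m ∨ (v : ℕ) = m))) ∨
        ((v : ℕ) + 1 = u ∨ ((v : ℕ) = 0 ∧ ((u : ℕ) + 1 = m ∨ (u : ℕ) = m))) := by
  rw [labelledLineTadpole, SimpleGraph.sup_adj, cycleUnionPath_adj_iff hm,
    SimpleGraph.fromRel_adj]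
  simp only [ne_eq, Fin.ext_iff]
  omega

lemma chromaticFn_labelledLineTadpole {m l : ℕ} (hm : 3 ≤ m) :
    chromaticFn (labelledLineTadpole m l) = lineTadpoleFn m (m + l) := by
  ext s
  simp only [chromaticFn, lineTadpoleFn, labelledLineTadpole_adj_iff hm]
  congr 1
  refine propext ⟨fun h j k hjk => h j k (Or.inl hjk), fun h j k hjk => ?_⟩
  rcases hjk with hjk | hjk
  · exact h j k hjk
  · exact (h k j hjk).symm

theorem isEPositive_labelledLineTadpole {m l : ℕ} (hm : 3 ≤ m) (hl : 1 ≤ l) :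
    IsEPositive (labelledLineTadpole m l) := by
  obtain ⟨m, rfl⟩ := Nat.exists_eq_add_of_le' (by omega : 1 ≤ m)
  obtain ⟨l, rfl⟩ := Nat.exists_eq_add_of_le' hl
  refine ⟨Fin.last (m + 1 + l), rfl, isEPositiveMod_of_mem_posCone ?_⟩
  rw [chromaticFn_labelledLineTadpole hm]
  exact lineTadpoleFn_mem m l

/-! ### The isomorphism with the line graph -/

/-- The preceding vertex of the tadpole; the first vertex is preceded by the last one of the
cycle. -/
def tadpolePred {m l : ℕ} (hm : 3 ≤ m) (i : Fin (m + l)) : Fin (m + l) :=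
  if h : (i : ℕ) = 0 then ⟨m - 1, by omega⟩ else ⟨i - 1, by omega⟩

lemma val_tadpolePred {m l : ℕ} (hm : 3 ≤ m) (i : Fin (m + l)) :
    ((i : ℕ) = 0 ∧ (tadpolePred hm i : ℕ) + 1 = m) ∨ ((tadpolePred hm i : ℕ) + 1 = i) := by
  unfold tadpolePred
  split_ifs with h <;> simp only <;> omega

/-- The edge of the tadpole that joins a vertex to the preceding one. -/
def tadpoleEdge {m l : ℕ} (hm : 3 ≤ m) (i : Fin (m + l)) : (tadpole m l).edgeSet :=
  ⟨s(tadpolePred hm i, i), by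
    have := val_tadpolePred hm i
    rw [SimpleGraph.mem_edgeSet, tadpole_adj_iff hm]
    omega⟩

/-- There are as many edges as vertices, and each edge is named by its later end along the cycle or
path. Two vertices naming the same edge would precede each other, which `3 ≤ m` excludes. -/
lemma tadpoleEdge_bijective {m l : ℕ} (hm : 3 ≤ m) :
    Function.Bijective (tadpoleEdge (m := m) (l := l) hm) := by
  constructor
  · intro i j hij
    have hi := val_tadpolePred hm i
    have hj := val_tadpolePred hm j
    have := congrArg Subtype.val hij
    simp only [tadpoleEdge, Sym2.eq_iff, Fin.ext_iff] at this
    rw [Fin.ext_iff]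
    omega
  · rintro ⟨e, he⟩
    induction e using Sym2.ind with
    | _ u v =>
      have key : ∀ u v : Fin (m + l), ((u : ℕ) + 1 = v ∨ ((v : ℕ) = 0 ∧ (u : ℕ) + 1 = m)) →
          tadpolePred hm v = u := by
        intro u v huv
        have hv := val_tadpolePred hm v
        rw [Fin.ext_iff]
        omega
      rw [SimpleGraph.mem_edgeSet, tadpole_adj_iff hm] at he
      by_cases h : (u : ℕ) + 1 = v ∨ ((v : ℕ) = 0 ∧ (u : ℕ) + 1 = m)
      · exact ⟨v, Subtype.ext (by simp only [tadpoleEdge, key u v h])⟩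
      · refine ⟨u, Subtype.ext ?_⟩
        simp only [tadpoleEdge, key v u (by omega), Sym2.eq_swap]

/-- Consecutive labels name edges sharing a vertex. The only vertex on three edges is the attaching
vertex `v_m`, and these edges, named by `v_1`, `v_m` and `v_{m+1}`, form the triangle. -/
theorem nonempty_iso_lineGraph_tadpole {m l : ℕ} (hm : 3 ≤ m) :
    Nonempty (labelledLineTadpole m l ≃g (tadpole m l).lineGraph) := by
  refine ⟨⟨Equiv.ofBijective _ (tadpoleEdge_bijective hm), ?_⟩⟩
  intro i j
  rw [SimpleGraph.lineGraph_adj_iff_exists, labelledLineTadpole_adj_iff hm,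
    (Equiv.injective _).ne_iff, ne_eq, Fin.ext_iff]
  have hi := val_tadpolePred hm i
  have hj := val_tadpolePred hm j
  simp only [Equiv.ofBijective_apply, tadpoleEdge, Sym2.mem_iff]
  have : (∃ v, (v = tadpolePred hm i ∨ v = i) ∧ (v = tadpolePred hm j ∨ v = j)) ↔
      (tadpolePred hm i = tadpolePred hm j ∨ tadpolePred hm i = j ∨ i = tadpolePred hm j ∨
        i = j) := by
    constructor
    · rintro ⟨v, rfl | rfl, h | h⟩ <;> tauto
    · rintro (h | h | h | h)
      exacts [⟨_, Or.inl rfl, Or.inl h⟩, ⟨_, Or.inl rfl, Or.inr h⟩, ⟨_, Or.inr rfl, Or.inl h⟩,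
        ⟨_, Or.inr rfl, Or.inr h⟩]
  rw [this]
  clear this
  simp only [Fin.ext_iff]
  omega

end

end NCSym

theorem mainTheorem1 (m l : ℕ) (hm : 3 ≤ m) (hl : 1 ≤ l) :
    Nonempty (NCSym.labelledLineTadpole m l ≃g (NCSym.tadpole m l).lineGraph) ∧
      NCSym.IsEPositive (NCSym.labelledLineTadpole m l) :=
  ⟨NCSym.nonempty_iso_lineGraph_tadpole hm, NCSym.isEPositive_labelledLineTadpole hm hl⟩
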